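/- Let $K$ be a commutative ring. Let ${\mathcal H}_{NCK}$ be the noncommutative Connes–Kreimer algebra, with basis $Y_F$ indexed by plane forests (graded by the number of nodes) and coproduct given by admissible cuts, and let $X_F$ be the dual basis of the graded dual ${\mathcal H}_{NCK}^*$; thus the coefficient of $X_F$ in $X_{F'}X_{F''}$ is the number of labellings of the nodes of $F$ by $1,2$, nondecreasing from bottom to top, such that the nodes labelled $1$ (resp. $2$) form the plane forest $F'$ (resp. $F''$). Let ${\bf Sym}$ be the algebra of noncommutative symmetric functions, freely generated by $S_1,S_2,\dots$, embedded in ${\mathcal H}_{NCK}^*$ by the algebra morphism $S_n\mapsto\sum_{|F|=n}X_F$, and identify its component of degree $n$ with the descent algebra in $K[\mathfrak S_n]$, the product $S_{i_1}\cdots S_{i_r}$ being the sum of the permutations with descent set contained in $\{i_1,i_1+i_2,\dots,i_1+\cdots+i_{r-1}\}$ (permutations are regarded as multilinear words $\sigma(1)\sigma(2)\cdots\sigma(n)$). Proposition. Let $n\ge 1$. The right Dynkin element $\bar\Psi_n=[1,[2,[3,\ldots[n-1,n]\ldots]]]$ and the left Dynkin element $\Psi_n=[\ldots[[1,2],3],\ldots,n]$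 (brackets being commutators of words) each correspond to a unique element of ${\bf Sym}$ of degree $n$. In ${\mathcal H}_{NCK}^*$, the right Dynkin element is the sum of all plane trees with $n$ nodes, $$\bar\Psi_n=\sum_{|T|=n}X_T ,$$ and the left Dynkin element is the linear tree $L_n$ with $n$ nodes, an iterated preLie product of $n$ factors $X_\bullet$: $$\Psi_n=X_{L_n}=((X_\bullet\triangleright X_\bullet)\triangleright\cdots)\triangleright X_\bullet ,$$ where, for plane trees $T_1,T_2$, $X_{T_1}\triangleright X_{T_2}$ is the sum of the $X_T$ over all ways of grafting $T_1$ on a node of $T_2$ (one term for each node of $T_2$ and each position among the children of that node). -/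

import Mathlib

namespace NCK

/-- Plane forests. `nil` is the empty forest; `cons C R` is the plane forest whose first (leftmost)
tree consists of a root above the plane forest `C` of its children subtrees, and whose other trees
form the plane forest `R`. -/
inductive PlaneForest : Type where
  | nil : PlaneForest
  | cons (children rest : PlaneForest) : PlaneForest
  deriving DecidableEq

/-- A plane tree is a root together with the plane forest of its children subtrees. -/
@[ext] structure PlaneTree : Type where
  children : PlaneForest
  deriving DecidableEq

namespace PlaneForest

/-- Number of nodes. -/
def size : PlaneForest → ℕ
  | nil => 0
  | cons C R => size C + 1 + size R

/-- Concatenation of plane forests. -/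
def append : PlaneForest → PlaneForest → PlaneForest
  | nil, G => G
  | cons C R, G => cons C (append R G)

/-- The list of admissible cuts of `F`, i.e. of all labellings of the nodes of `F` by `1` and `2`
that are nondecreasing from bottom to top (a node labelled `1` has all its descendants
labelled `1`), each recorded as the pair of plane forests
(restriction of `F` to the nodes labelled `1`, restriction of `F` to the nodes labelled `2`).
In the recursive clause, the first list has the first root labelled `1`, the second one has it
labelled `2`. -/
def cuts : PlaneForest → List (PlaneForest × PlaneForest)
  | nil => [(nil, nil)]
  | cons C R =>
      (cuts R).map (fun r => (cons C r.1, r.2)) ++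
        (cuts C).flatMap (fun c => (cuts R).map (fun r => (append c.1 r.1, cons c.2 r.2)))

/-- The finite set of plane forests with `n` nodes. -/
def ofSize : ℕ → Finset PlaneForest
  | 0 => {nil}
  | n + 1 =>
      (Finset.univ : Finset (Fin (n + 1))).biUnion fun i =>
        (ofSize i ×ˢ ofSize (n - i)).image fun p => cons p.1 p.2

theorem mem_ofSize (F : PlaneForest) : ∀ n : ℕ, F ∈ ofSize n ↔ F.size = n := by
  induction F with
  | nil =>
    intro n
    cases n with
    | zero => simp [ofSize, size]
    | succ n => simp [ofSize, size]
  | cons C R ihC ihR =>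
    intro n
    cases n with
    | zero => simp [ofSize, size]
    | succ n =>
      simp only [ofSize, Finset.mem_biUnion, Finset.mem_univ, true_and, Finset.mem_image,
        Finset.mem_product, Prod.exists, cons.injEq, size]
      constructor
      · rintro ⟨i, a, b, ⟨ha, hb⟩, rfl, rfl⟩
        have h1 := (ihC _).1 ha
        have h2 := (ihR _).1 hb
        omega
      · intro h
        refine ⟨⟨C.size, by omega⟩, C, R, ⟨(ihC _).2 rfl, (ihR _).2 ?_⟩, rfl, rfl⟩
        simp only
        omega

/-- The linear (unary) tree with `n` nodes (the empty forest for `n = 0`). -/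
def linear : ℕ → PlaneForest
  | 0 => nil
  | n + 1 => cons (linear n) nil

/-- All ways of inserting the tree `T` in the plane forest `F`, either as a new component, at any
place among the components of `F`, or as a new child subtree of some node of `F`, at any place
among the children of that node. -/
def insertions (T : PlaneTree) : PlaneForest → List PlaneForest
  | nil => [cons T.children nil]
  | cons C R =>
      cons T.children (cons C R) ::
        ((insertions T C).map (fun C' => cons C' R) ++
          (insertions T R).map (fun R' => cons C R'))

end PlaneForest

namespace PlaneTree

/-- A plane tree as a plane forest with one component. -/
def toForest (T : PlaneTree) : PlaneForest := .cons T.children .nil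

/-- The tree with one node. -/
def single : PlaneTree := ⟨.nil⟩

/-- The finite set of plane trees with `n` nodes. -/
def ofSize : ℕ → Finset PlaneTree
  | 0 => ∅
  | n + 1 => (PlaneForest.ofSize n).image PlaneTree.mk

theorem mem_ofSize (T : PlaneTree) (n : ℕ) : T ∈ ofSize n ↔ T.toForest.size = n := by
  cases n with
  | zero => simp [ofSize, toForest, PlaneForest.size]
  | succ n =>
    rcases T with ⟨C⟩
    simp [ofSize, toForest, PlaneForest.size, PlaneForest.mem_ofSize]

/-- All plane trees obtained by grafting `T₁` on a node of `T₂` (one tree for each node `v` of `T₂`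
and each place among the children of `v`). -/
def graftings (T₁ T₂ : PlaneTree) : List PlaneTree :=
  (PlaneForest.insertions T₁ T₂.children).map PlaneTree.mk

end PlaneTree

noncomputable section

variable (K : Type*) [CommRing K]

/-- The graded dual of the noncommutative Connes-Kreimer algebra: the free module on the
basis `X F` dual to the basis of plane forests. -/
abbrev HDual : Type _ := PlaneForest →₀ K

/-- The basis element `X_F`. -/
def X (F : PlaneForest) : HDual K := Finsupp.single F 1

/-- The product of two basis elements: the coefficient of `X_F` in `X_{F'} X_{F''}` is the number of
admissible cuts of `F` giving `F'` and `F''`. -/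
def mulX (F' F'' : PlaneForest) : HDual K :=
  ∑ F ∈ PlaneForest.ofSize (F'.size + F''.size), (F.cuts.count (F', F'') : K) • X K F

variable {K}

/-- The product of the graded dual, dual to the coproduct by admissible cuts. -/
def mul (f g : HDual K) : HDual K :=
  f.sum fun F' a => g.sum fun F'' b => (a * b) • mulX K F' F''

variable (K)

/-- The image of the complete noncommutative symmetric function `S_n` in the dual:
the sum of all plane forests with `n` nodes. -/
def complete (n : ℕ) : HDual K := ∑ F ∈ PlaneForest.ofSize n, X K F

/-- The image of `S^I = S_{i₁} S_{i₂} ⋯ S_{i_r}`. -/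
def completeProd {n : ℕ} (I : Composition n) : HDual K :=
  (I.blocks.map (complete K)).foldr mul (X K .nil)

/-- The component of degree `n` of the algebra of noncommutative symmetric functions: the free
module on the products `S^I`, `I` a composition of `n`. -/
abbrev NSym (n : ℕ) : Type _ := Composition n →₀ K

/-- The embedding of noncommutative symmetric functions in the dual
noncommutative Connes-Kreimer algebra. -/
def toHDual (n : ℕ) : NSym K n →ₗ[K] HDual K :=
  Finsupp.linearCombination K (completeProd K)

/-- The descent set of a permutation `σ` of `{0, …, n - 1}`: the `d` in `{1, …, n - 1}` such that,
in the word `σ(0) σ(1) ⋯ σ(n - 1)`, the `d`-th letter is greater than the next one. -/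
def descentSet {n : ℕ} (σ : Equiv.Perm (Fin n)) : Finset (Fin (n + 1)) :=
  {d | ∃ i j : Fin n, (i : ℕ) + 1 = d ∧ (j : ℕ) = d ∧ σ j < σ i}

/-- The identification of noncommutative symmetric functions of degree `n` with elements of the
descent algebra in the group algebra of the symmetric group: `S^I` is the sum of the permutations
whose descents all belong to `{i₁, i₁ + i₂, …, i₁ + ⋯ + i_{r-1}}`.
(`I.boundaries` consists of these partial sums together with `0` and `n`, which are never
descents.) -/
def toGroupAlgebra (n : ℕ) : NSym K n →ₗ[K] MonoidAlgebra K (Equiv.Perm (Fin n)) :=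
  Finsupp.linearCombination K fun I : Composition n =>
    ∑ σ : Equiv.Perm (Fin n) with descentSet σ ⊆ I.boundaries, MonoidAlgebra.of K _ σ

/-- The identification of the group algebra of the symmetric group with the multilinear part of the
free associative algebra on `n` letters: `σ` is the word `σ(0) σ(1) ⋯ σ(n - 1)`. -/
def toWords (n : ℕ) : MonoidAlgebra K (Equiv.Perm (Fin n)) →ₗ[K] FreeAlgebra K (Fin n) :=
  (Finsupp.linearCombination K fun σ : Equiv.Perm (Fin n) =>
    (List.ofFn fun i => FreeAlgebra.ι K (σ i)).prod) ∘ₗ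
      (MonoidAlgebra.coeffLinearEquiv K).toLinearMap

/-- The left-nested bracket `[…[[a₁, a₂], a₃], …, aₙ]`. -/
def leftBracket {A : Type*} [Ring A] : List A → A
  | [] => 0
  | a :: l => l.foldl (fun x y => ⁅x, y⁆) a

/-- The right-nested bracket `[a₁, [a₂, […, [aₙ₋₁, aₙ]…]]]`. -/
def rightBracket {A : Type*} [Ring A] : List A → A
  | [] => 0
  | [a] => a
  | a :: b :: l => ⁅a, rightBracket (b :: l)⁆

/-- The left Dynkin element `[…[[1, 2], 3], …, n]`, as a combination of words. -/
def leftDynkin (n : ℕ) : FreeAlgebra K (Fin n) := leftBracket (List.ofFn (FreeAlgebra.ι K))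

/-- The right Dynkin element `[1, [2, […, [n - 1, n]…]]]`, as a combination of words. -/
def rightDynkin (n : ℕ) : FreeAlgebra K (Fin n) := rightBracket (List.ofFn (FreeAlgebra.ι K))

/-- The module spanned by the `X_T`, `T` a plane tree. -/
abbrev TreeSpan : Type _ := PlaneTree →₀ K

/-- The inclusion of the span of the `X_T`, `T` a plane tree, in the dual. -/
def treeIncl : TreeSpan K →ₗ[K] HDual K := Finsupp.lmapDomain K K PlaneTree.toForest

variable {K}

/-- The preLie product: `X_{T₁} ▷ X_{T₂}` is the sum of the `X_T` for `T` obtained by grafting `T₁`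
on a node of `T₂`. -/
def preLie (x y : TreeSpan K) : TreeSpan K :=
  x.sum fun T₁ a => y.sum fun T₂ b =>
    (a * b) • ((PlaneTree.graftings T₁ T₂).map fun T => Finsupp.single T (1 : K)).sum

end

end NCK

namespace NCK

/-! Both identifications of `Sym` are instances of one construction. Given a graded coproduct `Δ`
and a function `w`, send `S_k` to the restriction of `w` to size `k`, and `S^I` to a right-nested
iterated convolution. For `HDual` take `Δ = cuts` and `w = 1`. For words take `Δ = splits` (two
complementary subwords) and let `w` be the product of the letters; evaluating at the word `1 2 … n`
gives the sum of the permutations that increase on each block of `I`, that is, whose descents lie in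
the boundaries of `I`.

The candidates are given by explicit coefficients on the `S^I`: with `I = (i₁, …, i_r)`, these are
`(-1)^(r-1) i₁` for the right element and `(-1)^(r-1) i_r` for the left one. Writing `D` for
multiplication by the size, they are characterised by convolution equations: the right element is
`(D w) * e`, where `w * e` is the unit, and the left element is the solution `p` of `w * p = D w`.
`blockSum_psiBar` and `blockSum_psi` prove this by recursion on the first block; coassociativity is
never needed.

The equations are then checked on each side. On forests, `e` is a signed indicator of edgeless
forests, `(D 1) * e` is the indicator of trees (`conv_size_antipodeFn`), and the indicator of linear
trees solves the second equation (`conv_linearFn`). On words, `e` reverses a word with a sign, and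
the solutions are the nested brackets (`conv_length_wordAntipode`, `conv_leftBracket`). Uniqueness
in `Sym` is the injectivity of `toGroupAlgebra` and `toWords`. -/

/-! ### Sums over compositions -/

/-- A composition of `n + 1` is a first block `j + 1` followed by a composition of `n - j`. All
recursions on the coefficients of the `S^I` go through this. -/
theorem sum_composition_succ {M : Type*} [AddCommMonoid M] (n : ℕ) (f : List ℕ → M) :
    ∑ I : Composition (n + 1), f I.blocks =
      ∑ j ∈ Finset.range (n + 1), ∑ J : Composition (n - j), f ((j + 1) :: J.blocks) := by
  rw [Finset.sum_sigma']
  symm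
  refine Finset.sum_bij'
    (i := fun p hp => (⟨(p.1 + 1) :: p.2.blocks, ?_, ?_⟩ : Composition (n + 1)))
    (j := fun I _ => ⟨I.blocks.headI - 1, ⟨I.blocks.tail, ?_, ?_⟩⟩) ?_ ?_ ?_ ?_ ?_
  · intro i hi
    rcases List.mem_cons.1 hi with rfl | h
    · omega
    · exact p.2.blocks_pos h
  · have := Finset.mem_range.1 (Finset.mem_sigma.1 hp).1
    simp only [List.sum_cons, p.2.blocks_sum]
    omega
  · intro i hi
    exact I.blocks_pos (List.mem_of_mem_tail hi)
  · obtain ⟨L, hp, hs⟩ := I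
    cases L with
    | nil => simp at hs
    | cons a L =>
      have := hp (i := a) (by simp)
      simp only [List.sum_cons] at hs
      simp only [List.tail_cons, List.headI_cons]
      omega
  · simp
  · rintro ⟨L, hp, hs⟩ -
    cases L with
    | nil => simp at hs
    | cons a L =>
      have := hp (i := a) (by simp)
      simp only [List.sum_cons] at hs
      simp only [List.headI_cons, Finset.mem_sigma, Finset.mem_range, Finset.mem_univ, and_true]
      omega
  · rintro ⟨j, J⟩ -
    rfl
  · rintro ⟨L, hp, hs⟩ -
    cases L with
    | nil => simp at hs
    | cons a L =>
      have := hp (i := a) (by simp)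
      ext1
      simp only [List.headI_cons, List.tail_cons, List.cons.injEq, and_true]
      omega
  · intros
    rfl

theorem sum_composition_zero {M : Type*} [AddCommMonoid M] (f : List ℕ → M) :
    ∑ I : Composition 0, f I.blocks = f [] := by
  have h : ∀ I : Composition 0, I.blocks = [] := fun I =>
    List.length_eq_zero_iff.1 (Nat.le_zero.1 I.length_le)
  simp [h, composition_card]

theorem blocks_ne_nil {n : ℕ} (hn : n ≠ 0) (I : Composition n) : I.blocks ≠ [] := by
  intro h
  have := I.blocks_sum
  simp [h] at this
  omega

/-! ### Convolution equations characterising the Dynkin elements -/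

section Convolution

variable {α A : Type*} [Ring A]

/-- The convolution product of `f` and `g` with respect to the coproduct `Δ`. -/
def conv (Δ : α → List (α × α)) (f g : α → A) (x : α) : A :=
  ((Δ x).map fun c => f c.1 * g c.2).sum

/-- The restriction of `w` to the elements of size `k`. -/
def homog (sz : α → ℕ) (w : α → A) (k : ℕ) (x : α) : A :=
  if sz x = k then w x else 0

/-- The iterated convolution product of homogeneous components of `w`. -/
def blockProd (Δ : α → List (α × α)) (sz : α → ℕ) (w ε : α → A) : List ℕ → α → A
  | [] => ε
  | k :: L => conv Δ (homog sz w k) (blockProd Δ sz w ε L)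

/-- The combination of the `blockProd` over compositions of `n`, with coefficients `φ`. -/
def blockSum (Δ : α → List (α × α)) (sz : α → ℕ) (w ε : α → A) (φ : List ℕ → ℤ) (n : ℕ)
    (x : α) : A :=
  ∑ I : Composition n, φ I.blocks • blockProd Δ sz w ε I.blocks x

/-- The coefficients of the antipode of a complete function on the products `S^I`. -/
def antipodeCoeff (L : List ℕ) : ℤ := (-1) ^ L.length

/-- The coefficients of the right Dynkin element on the products `S^I`. -/
def psiBarCoeff : List ℕ → ℤ
  | [] => 0
  | k :: L => k * antipodeCoeff L

/-- The coefficients of the left Dynkin element on the products `S^I`. -/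
def psiCoeff : List ℕ → ℤ
  | [] => 0
  | k :: L => (if L = [] then (k : ℤ) else 0) - psiCoeff L

/-- A coproduct `Δ` graded by `sz`, for which `ε` is a right counit, and the restriction of `w` to
the size `0` a left counit. -/
structure IsGraded (Δ : α → List (α × α)) (sz : α → ℕ) (w ε : α → A) : Prop where
  size_add : ∀ x, ∀ c ∈ Δ x, sz c.1 + sz c.2 = sz x
  counit_left : ∀ (g : α → A) (x : α), conv Δ (homog sz w 0) g x = g x
  counit_right : ∀ (g : α → A) (x : α), conv Δ g ε x = g x
  counit_eq_zero : ∀ x, sz x ≠ 0 → ε x = 0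

variable {Δ : α → List (α × α)} {sz : α → ℕ} {w ε : α → A}

theorem conv_congr {f f' g g' : α → A} {x : α}
    (h : ∀ c ∈ Δ x, f c.1 * g c.2 = f' c.1 * g' c.2) : conv Δ f g x = conv Δ f' g' x := by
  unfold conv
  exact congrArg List.sum (List.map_congr_left h)

theorem conv_eq_zero {f g : α → A} {x : α}
    (h : ∀ c ∈ Δ x, f c.1 * g c.2 = 0) : conv Δ f g x = 0 := by
  apply List.sum_eq_zero
  simpa using fun a c d hc h' => h' ▸ h _ hc

theorem list_sum_map_finset_sum {β ι M : Type*} [AddCommMonoid M] (l : List β) (s : Finset ι)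
    (f : ι → β → M) :
    (l.map fun b => ∑ i ∈ s, f i b).sum = ∑ i ∈ s, (l.map (f i)).sum := by
  induction l with
  | nil => simp
  | cons a l ih => simp [ih, Finset.sum_add_distrib]

theorem list_sum_map_neg {β M : Type*} [AddCommGroup M] (l : List β) (f : β → M) :
    (l.map fun b => -f b).sum = -(l.map f).sum := by
  induction l with
  | nil => simp
  | cons a l ih => simp [ih, add_comm]

theorem list_sum_flatMap {β γ M : Type*} [AddCommMonoid M] (l : List β) (f : β → List γ)
    (g : γ → M) : ((l.flatMap f).map g).sum = (l.map fun b => ((f b).map g).sum).sum := by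
  induction l with
  | nil => simp
  | cons a l ih => simp [ih]

theorem conv_sum_left {ι : Type*} (s : Finset ι) (f : ι → α → A) (g : α → A) (x : α) :
    conv Δ (fun y => ∑ i ∈ s, f i y) g x = ∑ i ∈ s, conv Δ (f i) g x := by
  simp only [conv, Finset.sum_mul, list_sum_map_finset_sum]

theorem conv_zsmul_sum_right {ι : Type*} (s : Finset ι) (r : ι → ℤ) (f : α → A)
    (g : ι → α → A) (x : α) :
    conv Δ f (fun y => ∑ i ∈ s, r i • g i y) x = ∑ i ∈ s, r i • conv Δ f (g i) x := by
  simp only [conv, Finset.mul_sum, list_sum_map_finset_sum, List.smul_sum, List.map_map,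
    mul_smul_comm, Function.comp_def]

theorem blockProd_eq_zero (h : IsGraded Δ sz w ε) (L : List ℕ) :
    ∀ x, sz x ≠ L.sum → blockProd Δ sz w ε L x = 0 := by
  induction L with
  | nil => exact h.counit_eq_zero
  | cons k L ih =>
    intro x hx
    refine conv_eq_zero fun c hc => ?_
    have := h.size_add x c hc
    simp only [List.sum_cons] at hx
    by_cases hk : sz c.1 = k
    · rw [ih c.2 (by omega), mul_zero]
    · simp [homog, hk]

/-- On the terms of `Δ x`, the components of sizes `1, …, n + 1` make up all of `w` except its size
`0` part, which convolves with `g` to `g` by the left counit. -/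
theorem sum_homog (h : IsGraded Δ sz w ε) (g : α → A) {n : ℕ} {x : α} (hx : sz x = n + 1) :
    ∑ j ∈ Finset.range (n + 1), conv Δ (homog sz w (j + 1)) g x = conv Δ w g x - g x := by
  rw [eq_sub_iff_add_eq]
  rw [← h.counit_left g x]
  rw [← Finset.sum_range_succ' (fun j => conv Δ (homog sz w j) g x), ← conv_sum_left]
  refine conv_congr fun c hc => ?_
  have := h.size_add x c hc
  simp only [homog]
  rw [Finset.sum_ite_eq, if_pos (Finset.mem_range.2 (by omega))]

/-- Recursion on the first block. -/
theorem sum_composition_blockProd_succ (φ ψ : List ℕ → ℤ) (k : ℕ → ℤ)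
    (h : IsGraded Δ sz w ε) (e : α → A) (n : ℕ) (x : α) (hx : sz x = n + 1)
    (hφ : ∀ m ≤ n, ∀ y, sz y = m → blockSum Δ sz w ε ψ m y = e y)
    (hk : ∀ j L, φ ((j + 1) :: L) = k j * ψ L) :
    blockSum Δ sz w ε φ (n + 1) x =
      ∑ j ∈ Finset.range (n + 1), k j • conv Δ (homog sz w (j + 1)) e x := by
  unfold blockSum
  rw [sum_composition_succ n fun L => φ L • blockProd Δ sz w ε L x]
  refine Finset.sum_congr rfl fun j hj => ?_
  have hj := Finset.mem_range.1 hj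
  simp only [hk, blockProd, mul_smul, ← Finset.smul_sum]
  rw [← conv_zsmul_sum_right]
  congr 1
  refine conv_congr fun c hc => ?_
  have := h.size_add x c hc
  by_cases hc1 : sz c.1 = j + 1
  · rw [← hφ (n - j) (by omega) c.2 (by omega)]
    rfl
  · simp [homog, hc1]

/-- Adding a first block changes the sign, so by induction the sum is `-(w * e - e)`, and `w * e`
vanishes in positive size. -/
theorem blockSum_antipode (h : IsGraded Δ sz w ε) (e : α → A)
    (h0 : ∀ x, sz x = 0 → e x = ε x) (he : ∀ x, sz x ≠ 0 → conv Δ w e x = 0) (n : ℕ) :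
    ∀ x, sz x = n → blockSum Δ sz w ε antipodeCoeff n x = e x := by
  induction n using Nat.strong_induction_on with
  | _ n ih =>
    intro x hx
    cases n with
    | zero =>
      unfold blockSum
      rw [sum_composition_zero fun L => antipodeCoeff L • blockProd Δ sz w ε L x]
      simp [antipodeCoeff, blockProd, h0 x hx]
    | succ n =>
      rw [sum_composition_blockProd_succ antipodeCoeff antipodeCoeff (fun _ => -1) h e n x hx
        (fun m hm => ih m (by omega)) (fun j L => by simp [antipodeCoeff, pow_succ]),
        ← Finset.smul_sum, sum_homog h e hx, he x (by omega)]
      simp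

/-- After the first block the coefficients are those of the antipode, whose sum is `e`; the weight
of the first block turns `w` into size times `w`. -/
theorem blockSum_psiBar (h : IsGraded Δ sz w ε) (e : α → A)
    (h0 : ∀ x, sz x = 0 → e x = ε x) (he : ∀ x, sz x ≠ 0 → conv Δ w e x = 0) (n : ℕ) (x : α)
    (hx : sz x = n) :
    blockSum Δ sz w ε psiBarCoeff n x = conv Δ (fun y => (sz y : A) * w y) e x := by
  cases n with
  | zero =>
    unfold blockSum
    rw [sum_composition_zero fun L => psiBarCoeff L • blockProd Δ sz w ε L x]
    rw [conv_eq_zero]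
    · simp [psiBarCoeff]
    · intro c hc
      have := h.size_add x c hc
      simp [show sz c.1 = 0 by omega]
  | succ n =>
    rw [sum_composition_blockProd_succ psiBarCoeff antipodeCoeff (fun j => ((j + 1 : ℕ) : ℤ)) h e n
        x hx (fun m _ => blockSum_antipode h e h0 he m) (fun j L => rfl)]
    have : ∀ j : ℕ, ((j + 1 : ℕ) : ℤ) • conv Δ (homog sz w (j + 1)) e x =
        conv Δ (homog sz (fun y => (sz y : A) * w y) (j + 1)) e x := by
      intro j
      simp only [conv, List.smul_sum, List.map_map]
      congr 1
      refine List.map_congr_left fun c _ => ?_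
      by_cases hc : sz c.1 = j + 1 <;> simp [homog, hc, mul_assoc, add_mul]
    simp only [this]
    rw [← conv_sum_left]
    refine conv_congr fun c hc => ?_
    have := h.size_add x c hc
    simp only [homog]
    -- The sum starts at size `1`, which loses nothing: the factor `sz` kills the part of size `0`.
    rcases Nat.eq_zero_or_pos (sz c.1) with h1 | h1
    · simp [h1]
    · rw [Finset.sum_eq_single (sz c.1 - 1)]
      · rw [if_pos (by omega)]
      · intro b _ hb
        rw [if_neg (by omega)]
      · intro hb
        exact absurd (Finset.mem_range.2 (by omega)) hb

/-- The one-block composition contributes size times `w`, and the term `-psiCoeff L` contributes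
`-(w * p - p)` by induction. The equation for `p` leaves exactly `p`. -/
theorem blockSum_psi (h : IsGraded Δ sz w ε) (p : α → A)
    (h0 : ∀ x, sz x = 0 → p x = 0) (hp : ∀ x, conv Δ w p x = (sz x : A) * w x) (n : ℕ) :
    ∀ x, sz x = n → blockSum Δ sz w ε psiCoeff n x = p x := by
  induction n using Nat.strong_induction_on with
  | _ n ih =>
    intro x hx
    cases n with
    | zero =>
      unfold blockSum
      rw [sum_composition_zero fun L => psiCoeff L • blockProd Δ sz w ε L x]
      simp [psiCoeff, h0 x hx]
    | succ n =>
      have key := sum_composition_blockProd_succ (fun L => -psiCoeff L.tail) psiCoeff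
        (fun _ => -1) h p n x hx (fun m hm => ih m (by omega)) (fun j L => by simp)
      rw [← Finset.smul_sum, sum_homog h p hx, hp x] at key
      have split : blockSum Δ sz w ε psiCoeff (n + 1) x =
          blockSum Δ sz w ε (fun L => if L.tail = [] then (L.headI : ℤ) else 0) (n + 1) x +
            blockSum Δ sz w ε (fun L => -psiCoeff L.tail) (n + 1) x := by
        simp only [blockSum]
        rw [← Finset.sum_add_distrib]
        refine Finset.sum_congr rfl fun I _ => ?_
        rw [← add_smul]
        congr 1
        have := blocks_ne_nil (Nat.succ_ne_zero n) I
        obtain ⟨a, L, hL⟩ := List.exists_cons_of_ne_nil this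
        rw [hL]
        by_cases hn : L = [] <;> simp [psiCoeff, hn]
      have first :
          blockSum Δ sz w ε (fun L => if L.tail = [] then (L.headI : ℤ) else 0) (n + 1) x =
            (sz x : A) * w x := by
        unfold blockSum
        rw [sum_composition_succ n fun L =>
          (if L.tail = [] then (L.headI : ℤ) else 0) • blockProd Δ sz w ε L x,
          Finset.sum_eq_single n]
        · rw [Nat.sub_self, sum_composition_zero fun L =>
            (if ((n + 1) :: L).tail = [] then (((n + 1) :: L).headI : ℤ) else 0) •
              blockProd Δ sz w ε ((n + 1) :: L) x]
          simp [blockProd, h.counit_right, homog, hx]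
        · intro j hj hjn
          have := Finset.mem_range.1 hj
          refine Finset.sum_eq_zero fun J _ => ?_
          rw [if_neg (by simpa using blocks_ne_nil (by omega) J), zero_smul]
        · simp
      rw [split, first, key]
      simp

end Convolution
-- Cuts of plane forests and the solutions of the equations
section Forests
variable (K : Type*) [CommRing K]

namespace PlaneForest

theorem size_append (F G : PlaneForest) : (append F G).size = F.size + G.size := by
  induction F with
  | nil => simp [append, size]
  | cons C R _ ih => simp [append, size, ih]; omega

theorem size_eq_zero {F : PlaneForest} : F.size = 0 ↔ F = nil := by
  cases F <;> simp [size]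

theorem append_eq_nil {F G : PlaneForest} : append F G = nil ↔ F = nil ∧ G = nil := by
  cases F <;> simp [append]

theorem size_cuts (F : PlaneForest) : ∀ c ∈ cuts F, c.1.size + c.2.size = F.size := by
  induction F with
  | nil => simp [cuts, size]
  | cons C R ihC ihR =>
    intro c hc
    simp only [cuts, List.mem_append, List.mem_map, List.mem_flatMap] at hc
    rcases hc with ⟨r, hr, rfl⟩ | ⟨d, hd, r, hr, rfl⟩
    · have := ihR r hr
      simp only [size]
      omega
    · have h1 := ihR r hr
      have h2 := ihC d hd
      simp only [size, size_append]
      omega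

theorem sum_cuts_cons {M : Type*} [AddCommMonoid M] (C R : PlaneForest)
    (f : PlaneForest × PlaneForest → M) :
    ((cuts (cons C R)).map f).sum =
      ((cuts R).map fun r => f (cons C r.1, r.2)).sum +
        ((cuts C).map fun c =>
          ((cuts R).map fun r => f (append c.1 r.1, cons c.2 r.2)).sum).sum := by
  simp only [cuts, List.map_append, List.sum_append, list_sum_flatMap, List.map_map,
    Function.comp_def]

/-- There is exactly one cut with nothing labelled `1`. -/
theorem sum_cuts_fst_nil {M : Type*} [AddCommMonoid M] (F : PlaneForest) :
    ∀ g : PlaneForest → M, ((cuts F).map fun c => if c.1 = nil then g c.2 else 0).sum = g F := by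
  induction F with
  | nil => simp [cuts]
  | cons C R ihC ihR =>
    intro g
    rw [sum_cuts_cons]
    simp only [append_eq_nil, reduceCtorEq, if_false, List.map_const', List.sum_replicate,
      smul_zero, zero_add, ite_and]
    rw [← ihC fun C' => g (cons C' R)]
    congr 1
    refine List.map_congr_left fun c _ => ?_
    by_cases hc : c.1 = nil
    · simp only [hc, if_true, ihR fun R' => g (cons c.2 R')]
    · simp [hc]

/-- There is exactly one cut with nothing labelled `2`. -/
theorem sum_cuts_snd_nil {M : Type*} [AddCommMonoid M] (F : PlaneForest) :
    ∀ g : PlaneForest → M, ((cuts F).map fun c => if c.2 = nil then g c.1 else 0).sum = g F := by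
  induction F with
  | nil => simp [cuts]
  | cons C R _ ihR =>
    intro g
    rw [sum_cuts_cons]
    simpa using ihR fun R' => g (cons C R')

/-- Up to sign, the sum of the images of the elementary functions, i.e. the indicator function of
the forests without edges. -/
def antipodeFn : PlaneForest → K
  | nil => 1
  | cons C R => if C = nil then -antipodeFn R else 0

/-- The indicator function of nonempty linear trees. -/
def linearFn : PlaneForest → K
  | nil => 0
  | cons C R => if R = nil then (if C = nil then 1 else 0) + linearFn C else 0

/-- The indicator function of trees. -/
def treeFn : PlaneForest → K
  | nil => 0
  | cons _ R => if R = nil then 1 else 0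

/-- The unit of the dual, as a function on forests. -/
def unitFn (F : PlaneForest) : K := if F = nil then 1 else 0

theorem isGraded_cuts : IsGraded cuts size (fun _ => (1 : K)) (unitFn K) where
  size_add := size_cuts
  counit_left g F := by
    simpa [conv, homog, size_eq_zero] using sum_cuts_fst_nil F g
  counit_right g F := by
    simpa [conv, unitFn] using sum_cuts_snd_nil F g
  counit_eq_zero F hF := by
    simp [unitFn, ← size_eq_zero, hF]

/-- The label of the first root is flipped. If it is `2`, only cuts with all its descendants
labelled `1` survive, and these cancel the cuts labelling the whole first tree `1`. -/
theorem sum_antipodeFn (F : PlaneForest) :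
    ((cuts F).map fun c => antipodeFn K c.2).sum = unitFn K F := by
  induction F with
  | nil => simp [cuts, antipodeFn, unitFn]
  | cons C R _ _ =>
    rw [sum_cuts_cons]
    have := sum_cuts_snd_nil (M := K) C fun _ => -((cuts R).map fun r => antipodeFn K r.2).sum
    simp only [antipodeFn, unitFn, reduceCtorEq, if_false]
    rw [← eq_neg_iff_add_eq_zero, ← neg_eq_iff_eq_neg, ← this]
    congr 1
    refine List.map_congr_left fun c _ => ?_
    split_ifs
    · simp only [list_sum_map_neg]
    · simp

theorem conv_antipodeFn {F : PlaneForest} (hF : F.size ≠ 0) :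
    conv cuts (fun _ => 1) (antipodeFn K) F = 0 := by
  simp only [conv, one_mul, sum_antipodeFn, unitFn, ← size_eq_zero, if_neg hF]

/-- Under the same pairing of cuts the two sizes differ by the first root alone. What remains is the
sum of `antipodeFn` over the cuts of `R`, which is `1` if `R` is empty and `0` otherwise. -/
theorem conv_size_antipodeFn (F : PlaneForest) :
    conv cuts (fun G => (G.size : K) * 1) (antipodeFn K) F = treeFn K F := by
  cases F with
  | nil => simp [conv, cuts, treeFn, size]
  | cons C R =>
    simp only [conv]
    rw [sum_cuts_cons]
    have h2 := sum_cuts_snd_nil (M := K) C fun C' =>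
      -((cuts R).map fun r => ((C'.size : K) + r.1.size) * antipodeFn K r.2).sum
    have h1 := sum_antipodeFn K R
    have h3 : ((cuts C).map fun c => ((cuts R).map fun r =>
        (((append c.1 r.1).size : K) * 1) * antipodeFn K (cons c.2 r.2)).sum).sum =
        -((cuts R).map fun r => ((C.size : K) + r.1.size) * antipodeFn K r.2).sum := by
      rw [← h2]
      congr 1
      refine List.map_congr_left fun c _ => ?_
      by_cases hc : c.2 = nil
      · simp [hc, antipodeFn, size_append, list_sum_map_neg]
      · simp [hc, antipodeFn]
    rw [h3, ← list_sum_map_neg, ← List.sum_map_add]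
    simp only [treeFn]
    rw [unitFn] at h1
    rw [← h1]
    congr 1
    refine List.map_congr_left fun r _ => ?_
    simp only [size]
    push_cast
    ring

/-- The nodes labelled `2` are closed under ancestors, so they form a nonempty linear tree exactly
when they are the path from a root to some node: there is one such cut for each node. -/
theorem conv_linearFn (F : PlaneForest) :
    conv cuts (fun _ => 1) (linearFn K) F = (F.size : K) * 1 := by
  simp only [conv, one_mul, mul_one]
  induction F with
  | nil => simp [cuts, linearFn, size]
  | cons C R ihC ihR =>
    rw [sum_cuts_cons, ihR]
    have h1 := sum_cuts_snd_nil (M := K) C fun _ => 1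
    have h2 : ∀ c : PlaneForest × PlaneForest,
        ((cuts R).map fun r => linearFn K (cons c.2 r.2)).sum =
          (if c.2 = nil then 1 else 0) + linearFn K c.2 := fun c =>
      sum_cuts_snd_nil (M := K) R fun _ => (if c.2 = nil then 1 else 0) + linearFn K c.2
    simp only [h2, List.sum_map_add, h1, ihC, size]
    push_cast
    ring

theorem treeFn_eq (F : PlaneForest) (n : ℕ) (hF : F.size = n) :
    treeFn K F = (∑ T ∈ PlaneTree.ofSize n, X K T.toForest) F := by
  rw [Finsupp.finsetSum_apply]
  simp only [X, Finsupp.single_apply]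
  rcases F with _ | ⟨C, R⟩
  · simp [treeFn, PlaneTree.toForest]
  · by_cases hR : R = nil
    · subst hR
      rw [Finset.sum_eq_single ⟨C⟩]
      · simp [treeFn, PlaneTree.toForest]
      · intro T _ hT
        rw [if_neg]
        rintro h
        injection h with h
        exact hT (PlaneTree.ext h)
      · intro h
        exact absurd ((PlaneTree.mem_ofSize _ _).2 hF) h
    · rw [Finset.sum_eq_zero]
      · simp [treeFn, hR]
      · intro T _
        rw [if_neg]
        rintro h
        injection h with h h'
        exact hR h'.symm

theorem linearFn_eq (n : ℕ) : ∀ F : PlaneForest, F.size = n + 1 →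
    linearFn K F = X K (linear (n + 1)) F := by
  induction n with
  | zero =>
    rintro (_ | ⟨C, R⟩) hF
    · simp [size] at hF
    · have hC : C = nil := size_eq_zero.1 (by simp only [size] at hF; omega)
      have hR : R = nil := size_eq_zero.1 (by simp only [size] at hF; omega)
      simp [hC, hR, linearFn, X, linear]
  | succ n ih =>
    rintro (_ | ⟨C, R⟩) hF
    · simp [size] at hF
    · by_cases hR : R = nil
      · subst hR
        have hC : C.size = n + 1 := by simpa [size] using hF
        have hC' : C ≠ nil := fun h => by simp [h, size] at hC
        simp only [linearFn, if_true, hC', if_false, zero_add, ih C hC, X, Finsupp.single_apply]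
        rw [linear]
        conv_rhs => rw [linear]
        simp [linear]
      · simp [linearFn, hR, X, linear]

theorem size_linear (n : ℕ) : (linear n).size = n := by
  induction n with
  | zero => rfl
  | succ n ih => simp [linear, size, ih]

end PlaneForest

/-! ### From the product of the graded dual to convolution by cuts -/

open PlaneForest

theorem mulX_apply (F' F'' F : PlaneForest) :
    mulX K F' F'' F = (F.cuts.count (F', F'') : K) := by
  rw [mulX, Finsupp.finsetSum_apply]
  simp only [X, Finsupp.smul_apply, Finsupp.single_apply, smul_eq_mul, mul_ite, mul_one, mul_zero]
  rw [Finset.sum_ite_eq']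
  split_ifs with h
  · rfl
  -- Cuts preserve the total size, so the count is zero outside the summation range.
  · rw [mem_ofSize] at h
    rw [List.count_eq_zero_of_not_mem, Nat.cast_zero]
    exact fun hc => h (size_cuts F _ hc).symm

variable {K} in
theorem mul_apply (f g : HDual K) (F : PlaneForest) : mul f g F = conv cuts f g F := by
  simp only [mul, Finsupp.sum, conv, Finsupp.finsetSum_apply, Finsupp.smul_apply, mulX_apply,
    smul_eq_mul]
  induction cuts F with
  | nil => simp
  | cons c l ih =>
    simp only [List.map_cons, List.sum_cons, ← ih, List.count_cons, Nat.cast_add, mul_add,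
      Finset.sum_add_distrib]
    rw [add_comm]
    congr 1
    rcases c with ⟨a, b⟩
    have : ∀ x y : PlaneForest, (((if (a, b) == (x, y) then 1 else 0 : ℕ) : ℕ) : K) =
        (if a = x then 1 else 0) * (if b = y then 1 else 0) := by
      intro x y
      by_cases h1 : a = x <;> by_cases h2 : b = y <;> simp [h1, h2]
    simp only [this]
    have h : ∀ x y : PlaneForest, f x * g y * ((if a = x then 1 else 0) * if b = y then 1 else 0) =
        (if a = x then f x else 0) * (if b = y then g y else 0) := by
      intro x y
      split_ifs <;> simp
    simp only [h, ← Finset.mul_sum, ← Finset.sum_mul, Finset.sum_ite_eq, Finsupp.mem_support_iff]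
    congr 1 <;> split_ifs with h' <;> simp_all

theorem complete_apply (n : ℕ) : ⇑(complete K n) = homog size (fun _ => (1 : K)) n := by
  funext F
  simp [complete, homog, Finsupp.finsetSum_apply, X, Finsupp.single_apply, mem_ofSize]

theorem completeProd_apply {n : ℕ} (I : Composition n) :
    ⇑(completeProd K I) = blockProd cuts size (fun _ => (1 : K)) (unitFn K) I.blocks := by
  unfold completeProd
  induction I.blocks with
  | nil =>
    funext F
    simp [blockProd, X, unitFn, Finsupp.single_apply, eq_comm]
  | cons k L ih =>
    funext F
    simp only [List.map_cons, List.foldr_cons, mul_apply, ih, blockProd, complete_apply]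

/-- The combination of the products `S^I` with integer coefficients `φ`. -/
noncomputable def nsymOf (φ : List ℕ → ℤ) (n : ℕ) : NSym K n :=
  ∑ I : Composition n, Finsupp.single I (φ I.blocks : K)

theorem toHDual_nsymOf_apply (φ : List ℕ → ℤ) (n : ℕ) (F : PlaneForest) :
    toHDual K n (nsymOf K φ n) F =
      blockSum cuts size (fun _ => (1 : K)) (unitFn K) φ n F := by
  simp [toHDual, nsymOf, blockSum, Finsupp.finsetSum_apply, completeProd_apply]

/-- Each `S^I` is supported on forests of size `n`, so only these have to be compared. -/
theorem toHDual_nsymOf_eq (φ : List ℕ → ℤ) (n : ℕ) (x : HDual K)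
    (hx : ∀ F, F.size ≠ n → x F = 0)
    (h : ∀ F, F.size = n → blockSum cuts size (fun _ => (1 : K)) (unitFn K) φ n F = x F) :
    toHDual K n (nsymOf K φ n) = x := by
  ext F
  rw [toHDual_nsymOf_apply]
  by_cases hF : F.size = n
  · exact h F hF
  · rw [hx F hF]
    refine Finset.sum_eq_zero fun I _ => ?_
    rw [blockProd_eq_zero (isGraded_cuts K) _ _ (by rwa [I.blocks_sum]), smul_zero]

theorem toHDual_psiBar (n : ℕ) :
    toHDual K n (nsymOf K psiBarCoeff n) = ∑ T ∈ PlaneTree.ofSize n, X K T.toForest := by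
  refine toHDual_nsymOf_eq K _ n _ (fun F hF => ?_) fun F hF => ?_
  · rw [Finsupp.finsetSum_apply]
    refine Finset.sum_eq_zero fun T hT => ?_
    rw [X, Finsupp.single_apply, if_neg]
    rintro rfl
    exact hF ((PlaneTree.mem_ofSize _ _).1 hT)
  · rw [← treeFn_eq K F n hF, ← conv_size_antipodeFn]
    refine blockSum_psiBar (isGraded_cuts K) _ (fun G hG => ?_) (fun G => conv_antipodeFn K) n F hF
    simp [size_eq_zero.1 hG, antipodeFn, unitFn]

theorem toHDual_psi (n : ℕ) (hn : 1 ≤ n) :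
    toHDual K n (nsymOf K psiCoeff n) = X K (linear n) := by
  refine toHDual_nsymOf_eq K _ n _ (fun F hF => ?_) fun F hF => ?_
  · rw [X, Finsupp.single_apply, if_neg]
    rintro rfl
    exact hF (size_linear n)
  · obtain ⟨n, rfl⟩ : ∃ m, n = m + 1 := ⟨n - 1, by omega⟩
    rw [← linearFn_eq K n F hF]
    refine blockSum_psi (isGraded_cuts K) _ (fun G hG => ?_) (conv_linearFn K) _ F hF
    simp [size_eq_zero.1 hG, linearFn]

/-- The one-node tree has a single place for grafting, so each step adds a root below the previous
tree. -/
theorem preLie_iterate_single (n : ℕ) :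
    (fun x => preLie x (Finsupp.single PlaneTree.single 1))^[n]
      (Finsupp.single PlaneTree.single 1) =
        (Finsupp.single ⟨linear n⟩ 1 : TreeSpan K) := by
  induction n with
  | zero => rfl
  | succ n ih =>
    rw [Function.iterate_succ_apply', ih]
    simp [preLie, PlaneTree.graftings, insertions, PlaneTree.single, linear]

theorem treeIncl_preLie_iterate (n : ℕ) (hn : 1 ≤ n) :
    treeIncl K ((fun x => preLie x (Finsupp.single PlaneTree.single 1))^[n - 1]
      (Finsupp.single PlaneTree.single 1)) = X K (linear n) := by
  obtain ⟨n, rfl⟩ : ∃ m, n = m + 1 := ⟨n - 1, by omega⟩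
  rw [preLie_iterate_single]
  simp [treeIncl, X, linear, PlaneTree.toForest]

end Forests
-- Splittings of words and nested brackets
section Words
variable {α : Type*}

/-- The list of all ways of splitting a word into two complementary subwords. -/
def splits : List α → List (List α × List α)
  | [] => [([], [])]
  | a :: l => (splits l).map (fun p => (a :: p.1, p.2)) ++
      (splits l).map (fun p => (p.1, a :: p.2))

theorem sum_splits_cons {M : Type*} [AddCommMonoid M] (a : α) (l : List α)
    (f : List α × List α → M) :
    ((splits (a :: l)).map f).sum =
      ((splits l).map fun c => f (a :: c.1, c.2)).sum +
        ((splits l).map fun c => f (c.1, a :: c.2)).sum := by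
  simp only [splits, List.map_append, List.sum_append, List.map_map, Function.comp_def]

/-- Peeling off the last letter suits both brackets: it is the innermost letter of the right bracket
and the outermost one of the left bracket. -/
theorem sum_splits_concat {M : Type*} [AddCommMonoid M] (m : α) (l : List α) :
    ∀ f : List α × List α → M, ((splits (l ++ [m])).map f).sum =
      ((splits l).map fun c => f (c.1 ++ [m], c.2)).sum +
        ((splits l).map fun c => f (c.1, c.2 ++ [m])).sum := by
  induction l with
  | nil => simp [splits]
  | cons a l ih =>
    intro f
    rw [List.cons_append, sum_splits_cons, ih, ih, sum_splits_cons, sum_splits_cons]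
    simp only [List.cons_append]
    abel

theorem length_splits (l : List α) : ∀ c ∈ splits l, c.1.length + c.2.length = l.length := by
  induction l with
  | nil => simp [splits]
  | cons a l ih =>
    intro c hc
    simp only [splits, List.mem_append, List.mem_map] at hc
    rcases hc with ⟨p, hp, rfl⟩ | ⟨p, hp, rfl⟩ <;>
      · have := ih p hp
        simp only [List.length_cons]
        omega

theorem sum_splits_fst_nil {M : Type*} [AddCommMonoid M] (l : List α) :
    ∀ g : List α → M,
      ((splits l).map fun c => if c.1.length = 0 then g c.2 else 0).sum = g l := by
  induction l with
  | nil => simp [splits]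
  | cons a l ih =>
    intro g
    rw [sum_splits_cons]
    simpa using ih fun l' => g (a :: l')

theorem sum_splits_snd_nil {M : Type*} [AddCommMonoid M] (l : List α) :
    ∀ g : List α → M,
      ((splits l).map fun c => if c.2.length = 0 then g c.1 else 0).sum = g l := by
  induction l with
  | nil => simp [splits]
  | cons a l ih =>
    intro g
    rw [sum_splits_cons]
    simpa using ih fun l' => g (a :: l')

variable {A : Type*} [Ring A] (v : α → A)

/-- The product of the letters of a word. -/
def wordProd (l : List α) : A := (l.map v).prod

/-- The unit, as a function on words. -/
def wordUnit (l : List α) : A := if l.length = 0 then 1 else 0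

/-- The antipode of a word. -/
def wordAntipode (l : List α) : A := (-1) ^ l.length * wordProd v l.reverse

theorem wordProd_nil : wordProd v [] = 1 := rfl

theorem wordProd_append (l l' : List α) : wordProd v (l ++ l') = wordProd v l * wordProd v l' := by
  simp [wordProd]

theorem wordProd_cons (a : α) (l : List α) : wordProd v (a :: l) = v a * wordProd v l := by
  simp [wordProd]

theorem wordProd_singleton (a : α) : wordProd v [a] = v a := by simp [wordProd]

theorem wordAntipode_concat (l : List α) (m : α) :
    wordAntipode v (l ++ [m]) = -(v m * wordAntipode v l) := by
  have h : (-1 : A) ^ l.length * v m = v m * (-1) ^ l.length :=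
    ((Commute.neg_one_left (v m)).pow_left l.length).eq
  simp only [wordAntipode, List.length_append, List.length_singleton, pow_succ, mul_neg, mul_one,
    List.reverse_append, List.reverse_singleton, List.singleton_append, wordProd_cons, neg_mul,
    neg_inj]
  rw [← mul_assoc, h, mul_assoc]

theorem wordAntipode_cons (l : List α) (a : α) :
    wordAntipode v (a :: l) = -(wordAntipode v l * v a) := by
  simp [wordAntipode, pow_succ, wordProd_append, wordProd_singleton, mul_assoc]

theorem isGraded_splits :
    IsGraded splits List.length (wordProd v) (wordUnit : List α → A) where
  size_add := length_splits
  counit_left g l := by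
    rw [← sum_splits_fst_nil l g]
    refine congrArg List.sum (List.map_congr_left fun c _ => ?_)
    by_cases hc : c.1.length = 0
    · simp [homog, List.length_eq_zero_iff.1 hc, wordProd_nil]
    · simp [homog, List.length_eq_zero_iff.not.1 hc]
  counit_right g l := by
    rw [← sum_splits_snd_nil l g]
    refine congrArg List.sum (List.map_congr_left fun c _ => ?_)
    by_cases hc : c.2.length = 0 <;> simp [wordUnit]
  counit_eq_zero l hl := by simp only [wordUnit, if_neg hl]

/-- The last letter `m` contributes `v m` between the two factors whether it goes left or right,
with opposite signs. -/
theorem conv_wordAntipode {l : List α} (hl : l.length ≠ 0) :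
    conv splits (wordProd v) (wordAntipode v) l = 0 := by
  rcases List.eq_nil_or_concat l with rfl | ⟨l, m, rfl⟩
  · simp at hl
  · simp [conv, sum_splits_concat, wordAntipode_concat, wordProd_append, wordProd_singleton,
      mul_assoc, list_sum_map_neg]

/-- The right-nested bracket of `l ++ [m]`, expanded as a combination of words. -/
theorem rightBracket_concat (m : α) (l : List α) :
    rightBracket ((l ++ [m]).map v) =
      ((splits l).map fun c => wordProd v c.1 * (v m * wordAntipode v c.2)).sum := by
  induction l with
  | nil => simp [splits, rightBracket, wordProd, wordAntipode]
  | cons a l ih =>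
    obtain ⟨b, l', h⟩ : ∃ b l', (l ++ [m]).map v = b :: l' := List.exists_cons_of_ne_nil (by simp)
    -- In `[a, P] = aP - Pa` the first term puts `a` in front of the left subword; the second puts
    -- it, with a sign, at the end of the reversed right subword.
    rw [List.cons_append, List.map_cons, h, rightBracket, ← h, ih, Ring.lie_def, sum_splits_cons,
      sub_eq_add_neg, ← List.sum_map_mul_left, ← List.sum_map_mul_right, ← list_sum_map_neg]
    simp only [wordProd_cons, wordAntipode_cons, mul_assoc, mul_neg]

/-- Moving the last letter from the left subword to the right one changes the sign and lowers the
length weight by one, so each splitting of `l` keeps coefficient `1`. -/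
theorem conv_length_wordAntipode (l : List α) :
    conv splits (fun y => (y.length : A) * wordProd v y) (wordAntipode v) l =
      rightBracket (l.map v) := by
  rcases List.eq_nil_or_concat l with rfl | ⟨l, m, rfl⟩
  · simp [conv, splits, rightBracket]
  · rw [List.concat_eq_append, rightBracket_concat, conv, sum_splits_concat, ← List.sum_map_add]
    refine congrArg List.sum (List.map_congr_left fun c _ => ?_)
    simp only [wordProd_append, wordProd_singleton, wordAntipode_concat, List.length_append,
      List.length_singleton, Nat.cast_add, Nat.cast_one, mul_neg, add_mul, one_mul, mul_assoc]
    abel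

theorem leftBracket_concat {l : List A} (hl : l ≠ []) (m : A) :
    leftBracket (l ++ [m]) = ⁅leftBracket l, m⁆ := by
  obtain ⟨a, l, rfl⟩ := List.exists_cons_of_ne_nil hl
  simp [leftBracket]

/-- With `m` the last letter and `p` the bracket of a nonempty right subword, `m p + [p, m] = p m`,
so these terms reproduce the sum for `l` times `m`. An empty right subword gives one extra copy of
the word. -/
theorem conv_leftBracket (l : List α) :
    conv splits (wordProd v) (fun y => leftBracket (y.map v)) l =
      (l.length : A) * wordProd v l := by
  induction l using List.reverseRecOn with
  | nil => simp [conv, splits, leftBracket]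
  | append_singleton l m ih =>
    have h := sum_splits_snd_nil l fun y => wordProd v y * v m
    rw [conv, sum_splits_concat, wordProd_append, wordProd_singleton]
    simp only [conv] at ih
    rw [List.length_append, Nat.cast_add, add_mul, ← mul_assoc, ← ih, List.length_singleton,
      Nat.cast_one, one_mul, ← h, ← List.sum_map_mul_right, ← List.sum_map_add, ← List.sum_map_add]
    refine congrArg List.sum (List.map_congr_left fun c _ => ?_)
    by_cases hc : c.2 = []
    · simp [hc, leftBracket]
    · rw [List.map_append, List.map_singleton, leftBracket_concat (by simpa using hc),
        if_neg (by simpa using hc), Ring.lie_def, wordProd_append, wordProd_singleton]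
      noncomm_ring

theorem blockSum_psiBar_splits (l : List α) :
    blockSum splits List.length (wordProd v) wordUnit psiBarCoeff l.length l =
      rightBracket (l.map v) := by
  rw [← conv_length_wordAntipode]
  refine blockSum_psiBar (isGraded_splits v) _ (fun y hy => ?_) (fun y => conv_wordAntipode v)
    _ l rfl
  simp [List.length_eq_zero_iff.1 hy, wordAntipode, wordUnit, wordProd]

theorem blockSum_psi_splits (l : List α) :
    blockSum splits List.length (wordProd v) wordUnit psiCoeff l.length l =
      leftBracket (l.map v) := by
  refine blockSum_psi (isGraded_splits v) (fun y => leftBracket (y.map v)) (fun y hy => ?_)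
    (conv_leftBracket v) _ l rfl
  simp [List.length_eq_zero_iff.1 hy, leftBracket]

end Words
-- Iterated splittings as permutations with prescribed descents
section Descents
variable {α : Type*}

/-- The list of all words obtained by splitting `l` into successive blocks with sizes given by the
first argument. -/
def arrangements : List ℕ → List α → List (List α)
  | [], l => if l.length = 0 then [[]] else []
  | k :: L, l => (splits l).flatMap fun c =>
      if c.1.length = k then (arrangements L c.2).map (c.1 ++ ·) else []

theorem blockProd_splits {A : Type*} [Ring A] (v : α → A) (L : List ℕ) :
    ∀ l : List α, blockProd splits List.length (wordProd v) wordUnit L l =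
      ((arrangements L l).map (wordProd v)).sum := by
  induction L with
  | nil =>
    intro l
    by_cases h : l.length = 0 <;> simp [blockProd, arrangements, wordUnit, h, wordProd_nil]
  | cons k L ih =>
    intro l
    rw [arrangements, list_sum_flatMap, blockProd, conv]
    refine congrArg List.sum (List.map_congr_left fun c _ => ?_)
    by_cases h : c.1.length = k
    · simp [homog, h, ih, wordProd_append, List.sum_map_mul_left, Function.comp_def]
    · simp [homog, h]

variable [LinearOrder α]

theorem mem_splits {l : List α} (hl : l.Pairwise (· < ·)) :
    ∀ a b : List α, (a, b) ∈ splits l ↔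
      a.Pairwise (· < ·) ∧ b.Pairwise (· < ·) ∧ (a ++ b).Perm l := by
  induction l with
  | nil => intro a b; constructor <;> simp +contextual [splits]
  | cons x l ih =>
    rw [List.pairwise_cons] at hl
    obtain ⟨hx, hl⟩ := hl
    intro a b
    simp only [splits, List.mem_append, List.mem_map, Prod.exists, Prod.mk.injEq]
    constructor
    · rintro (⟨a, b, h, rfl, rfl⟩ | ⟨a, b, h, rfl, rfl⟩)
      · obtain ⟨ha, hb, hp⟩ := (ih hl a b).1 h
        refine ⟨List.pairwise_cons.2 ⟨fun y hy => hx y (hp.subset (by simp [hy])), ha⟩, hb, ?_⟩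
        simpa using hp
      · obtain ⟨ha, hb, hp⟩ := (ih hl a b).1 h
        refine ⟨ha, List.pairwise_cons.2 ⟨fun y hy => hx y (hp.subset (by simp [hy])), hb⟩, ?_⟩
        exact List.perm_middle.trans (hp.cons x)
    · rintro ⟨ha, hb, hp⟩
      have hle : ∀ y ∈ a ++ b, x ≤ y := fun y hy => by
        rcases List.mem_cons.1 (hp.subset hy) with rfl | h
        · exact le_rfl
        · exact (hx y h).le
      -- `x` is the least letter, so it comes first in whichever increasing part contains it.
      have head : ∀ (a : List α), a.Pairwise (· < ·) → (∀ y ∈ a, x ≤ y) → x ∈ a →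
          ∃ a', a = x :: a' := by
        rintro (_ | ⟨z, a⟩) ha hxa hxm
        · simp at hxm
        · rcases List.mem_cons.1 hxm with rfl | h
          · exact ⟨a, rfl⟩
          · exact absurd ((List.pairwise_cons.1 ha).1 x h) (not_lt.2 (hxa z (by simp)))
      rcases List.mem_append.1 (hp.symm.subset (List.mem_cons_self (a := x))) with h | h
      · obtain ⟨a', rfl⟩ := head a ha (fun y hy => hle y (by simp [hy])) h
        refine Or.inl ⟨a', b, (ih hl a' b).2 ⟨(List.pairwise_cons.1 ha).2, hb, ?_⟩, rfl, rfl⟩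
        simpa using hp
      · obtain ⟨b', rfl⟩ := head b hb (fun y hy => hle y (by simp [hy])) h
        refine Or.inr ⟨a, b', (ih hl a b').2 ⟨ha, (List.pairwise_cons.1 hb).2, ?_⟩, rfl, rfl⟩
        exact (List.perm_middle.symm.trans hp).cons_inv

theorem nodup_splits {l : List α} (hl : l.Pairwise (· < ·)) : (splits l).Nodup := by
  induction l with
  | nil => simp [splits]
  | cons x l ih =>
    rw [List.pairwise_cons] at hl
    obtain ⟨hx, hl⟩ := hl
    refine List.Nodup.append ((ih hl).map ?_) ((ih hl).map ?_) ?_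
    · rintro ⟨a, b⟩ ⟨a', b'⟩ h
      simpa using h
    · rintro ⟨a, b⟩ ⟨a', b'⟩ h
      simpa using h
    · rintro _ h1 h2
      obtain ⟨⟨a, b⟩, -, rfl⟩ := List.mem_map.1 h1
      obtain ⟨⟨a', b'⟩, h, h'⟩ := List.mem_map.1 h2
      simp only [Prod.mk.injEq] at h'
      have : x ∈ l := ((mem_splits hl a' b').1 h).2.2.subset (by simp [h'.1])
      exact lt_irrefl x (hx x this)

/-- The word `v` is increasing on each of the successive blocks with sizes given by the first
argument. -/
def BlockIncreasing : List ℕ → List α → Prop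
  | [], _ => True
  | k :: L, v => (v.take k).Pairwise (· < ·) ∧ BlockIncreasing L (v.drop k)

theorem mem_arrangements (L : List ℕ) :
    ∀ l : List α, l.Pairwise (· < ·) → l.length = L.sum →
      ∀ v, v ∈ arrangements L l ↔ v.Perm l ∧ BlockIncreasing L v := by
  induction L with
  | nil =>
    intro l _ hs v
    obtain rfl : l = [] := List.length_eq_zero_iff.1 hs
    simp [arrangements, BlockIncreasing]
  | cons k L ih =>
    intro l hl hs v
    rw [List.sum_cons] at hs
    simp only [arrangements, List.mem_flatMap, Prod.exists, BlockIncreasing]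
    constructor
    · rintro ⟨a, b, hab, hv⟩
      have hlen := length_splits l _ hab
      obtain ⟨ha, hb, hp⟩ := (mem_splits hl a b).1 hab
      split_ifs at hv with hk
      · obtain ⟨u, hu, rfl⟩ := List.mem_map.1 hv
        obtain ⟨hup, hui⟩ := (ih b hb (by simp only at hlen hk; omega) u).1 hu
        refine ⟨(hup.append_left a).trans hp, ?_, ?_⟩
        · rwa [List.take_left' hk]
        · rwa [List.drop_left' hk]
      · simp at hv
    · rintro ⟨hp, ha, hu⟩
      have hnd : v.Nodup := hp.nodup_iff.2 (hl.imp ne_of_lt)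
      have hlen := hp.length_eq
      -- The right part of the splitting is the sorted remainder of `v`; its own arrangement then
      -- restores the order in `v`.
      have hb : ((v.drop k).mergeSort (· ≤ ·)).Pairwise (· < ·) := by
        have h1 := List.pairwise_mergeSort' (α := α) (· ≤ ·) (v.drop k)
        have h2 : ((v.drop k).mergeSort (· ≤ ·)).Nodup :=
          (List.mergeSort_perm _ _).nodup_iff.2 (hnd.sublist (List.drop_sublist _ _))
        exact (h1.and h2).imp fun h => lt_of_le_of_ne h.1 h.2
      refine ⟨v.take k, (v.drop k).mergeSort (· ≤ ·), (mem_splits hl _ _).2 ⟨ha, hb, ?_⟩, ?_⟩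
      · refine ((List.mergeSort_perm _ _).append_left _).trans ?_
        rwa [List.take_append_drop]
      · rw [if_pos (by rw [List.length_take]; omega)]
        refine List.mem_map.2 ⟨v.drop k, (ih _ hb ?_ _).2 ⟨(List.mergeSort_perm _ _).symm, hu⟩,
          List.take_append_drop k v⟩
        rw [List.length_mergeSort, List.length_drop]
        omega

/-- A word determines its splitting: the left part is its prefix of length `k`, and the right part
is the sorted remainder. This allows the list sum to be read as a sum over permutations. -/
theorem nodup_arrangements (L : List ℕ) :
    ∀ l : List α, l.Pairwise (· < ·) → l.length = L.sum → (arrangements L l).Nodup := by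
  induction L with
  | nil =>
    intro l _ _
    rw [arrangements]
    split_ifs <;> simp
  | cons k L ih =>
    intro l hl hs
    rw [List.sum_cons] at hs
    refine List.nodup_flatMap.2 ⟨?_, (nodup_splits hl).imp_of_mem ?_⟩
    · rintro ⟨a, b⟩ hab
      have hlen := length_splits l _ hab
      split_ifs with hk
      · refine (ih b ((mem_splits hl a b).1 hab).2.1 ?_).map (List.append_right_injective a)
        simp only at hlen hk
        omega
      · simp
    · rintro ⟨a, b⟩ ⟨a', b'⟩ hab hab' hne
      have hlen := length_splits l _ hab
      have hlen' := length_splits l _ hab'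
      have hb := ((mem_splits hl a b).1 hab).2.1
      have hb' := ((mem_splits hl a' b').1 hab').2.1
      intro w hw hw'
      simp only at hw hw' hlen hlen'
      split_ifs at hw with hk
      · split_ifs at hw' with hk'
        · obtain ⟨u, hu, rfl⟩ := List.mem_map.1 hw
          obtain ⟨u', hu', h⟩ := List.mem_map.1 hw'
          obtain ⟨h1, h2⟩ := List.append_inj h (hk'.trans hk.symm)
          subst h1 h2
          have p1 := ((mem_arrangements L b hb (by omega) _).1 hu).1
          have p2 := ((mem_arrangements L b' hb' (by omega) _).1 hu').1
          exact hne (Prod.ext rfl ((p1.symm.trans p2).eq_of_pairwise'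
            (hb.imp le_of_lt) (hb'.imp le_of_lt)))
        · simp at hw'
      · simp at hw

theorem blockIncreasing_iff (L : List ℕ) :
    ∀ v : List α, v.Nodup → v.length = L.sum → (BlockIncreasing L v ↔
      ∀ (i : ℕ) (hi : i + 1 < v.length), v[i + 1] < v[i] →
        ∃ j ≤ L.length, (L.take j).sum = i + 1) := by
  induction L with
  | nil =>
    intro v _ hs
    simp only [List.sum_nil] at hs
    simp only [BlockIncreasing, true_iff]
    intro i hi
    omega
  | cons k L ih =>
    intro v hnd hs
    rw [List.sum_cons] at hs
    have hdl : (v.drop k).length = L.sum := by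
      rw [List.length_drop]
      omega
    rw [BlockIncreasing, ih _ (hnd.sublist (List.drop_sublist _ _)) hdl]
    constructor
    · rintro ⟨h1, h2⟩ i hi hd
      rcases lt_trichotomy (i + 1) k with h | h | h
      · rw [List.pairwise_iff_getElem] at h1
        have := h1 i (i + 1) (by rw [List.length_take]; omega) (by rw [List.length_take]; omega)
          (by omega)
        simp only [List.getElem_take] at this
        exact absurd hd this.not_gt
      · exact ⟨1, by simp, by simp [h]⟩
      · obtain ⟨m, rfl⟩ : ∃ m, i = k + m := ⟨i - k, by omega⟩
        obtain ⟨j, hj, hj'⟩ := h2 m (by omega) (by simpa [add_assoc] using hd)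
        exact ⟨j + 1, by simpa using hj, by simp [hj', add_assoc]⟩
    · intro h
      constructor
      · rw [← List.isChain_iff_pairwise, List.isChain_iff_getElem]
        intro i hi
        rw [List.length_take] at hi
        simp only [List.getElem_take]
        by_contra hc
        have hne : v[i] ≠ v[i + 1] := fun h' => by
          have := (List.Nodup.getElem_inj_iff hnd).1 h'
          omega
        -- A failure of increase would be a descent strictly inside the first block, but a partial
        -- sum of `k :: L` is either `0` or at least `k`.
        obtain ⟨j, hj, hj'⟩ := h i (by omega) (lt_of_le_of_ne (not_lt.1 hc) hne.symm)
        cases j with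
        | zero => simp at hj'
        | succ j =>
          simp only [List.take_succ_cons, List.sum_cons] at hj'
          omega
      · intro m hm hd
        have hdl' : (v.drop k).length = v.length - k := List.length_drop
        obtain ⟨j, hj, hj'⟩ := h (k + m) (by omega) (by simpa [add_assoc] using hd)
        cases j with
        | zero => simp at hj'
        | succ j =>
          refine ⟨j, by simpa using hj, ?_⟩
          simp only [List.take_succ_cons, List.sum_cons] at hj'
          omega

theorem descentSet_subset_iff {n : ℕ} (σ : Equiv.Perm (Fin n)) (I : Composition n) :
    descentSet σ ⊆ I.boundaries ↔ BlockIncreasing I.blocks (List.ofFn σ) := by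
  rw [blockIncreasing_iff _ _ (List.nodup_ofFn.2 σ.injective) (by simp [I.blocks_sum])]
  have hb : ∀ d : Fin (n + 1), d ∈ I.boundaries ↔
      ∃ j ≤ I.blocks.length, (I.blocks.take j).sum = d := by
    intro d
    simp only [Composition.boundaries, Finset.mem_map, Finset.mem_univ, true_and]
    constructor
    · rintro ⟨j, rfl⟩
      exact ⟨j, by have := j.2; rw [I.blocks_length]; omega, rfl⟩
    · rintro ⟨j, hj, h⟩
      exact ⟨⟨j, by rw [I.blocks_length] at hj; omega⟩, Fin.ext h⟩
  constructor
  · intro h i hi hd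
    simp only [List.length_ofFn] at hi
    simp only [List.getElem_ofFn] at hd
    have : (⟨i + 1, by omega⟩ : Fin (n + 1)) ∈ descentSet σ := by
      simp only [descentSet, Finset.mem_filter, Finset.mem_univ, true_and]
      exact ⟨⟨i, by omega⟩, ⟨i + 1, by omega⟩, rfl, rfl, hd⟩
    exact (hb _).1 (h this)
  · intro h d hd
    simp only [descentSet, Finset.mem_filter, Finset.mem_univ, true_and] at hd
    obtain ⟨i, j, hi, hj, hij⟩ := hd
    rw [hb, ← hi]
    refine h i (by rw [List.length_ofFn]; omega) ?_
    simp only [List.getElem_ofFn]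
    have : (⟨i + 1, by omega⟩ : Fin n) = j := Fin.ext (by simp; omega)
    rwa [this]

theorem exists_perm_of_perm_finRange {n : ℕ} {v : List (Fin n)} (h : v.Perm (List.finRange n)) :
    ∃ σ : Equiv.Perm (Fin n), List.ofFn σ = v := by
  have hl : v.length = n := by simpa using h.length_eq
  have hi : Function.Injective fun i => v.get (Fin.cast hl.symm i) :=
    (List.nodup_iff_injective_get.1 (h.nodup_iff.2 (List.nodup_finRange _))).comp
      (Fin.cast_injective _)
  refine ⟨Equiv.ofBijective _ (Finite.injective_iff_bijective.1 hi), ?_⟩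
  refine List.ext_getElem (by simp [hl]) fun i _ _ => ?_
  simp

variable (K : Type*) [CommRing K]

theorem toWords_of {n : ℕ} (σ : Equiv.Perm (Fin n)) :
    toWords K n (MonoidAlgebra.of K _ σ) = wordProd (FreeAlgebra.ι K) (List.ofFn σ) := by
  simp [toWords, wordProd, MonoidAlgebra.of, List.map_ofFn, Function.comp_def]

theorem sum_descentSet_subset {n : ℕ} (I : Composition n) :
    ∑ σ : Equiv.Perm (Fin n) with descentSet σ ⊆ I.boundaries,
        toWords K n (MonoidAlgebra.of K _ σ) =
      blockProd splits List.length (wordProd (FreeAlgebra.ι K)) wordUnit I.blocks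
        (List.finRange n) := by
  have hs : (List.finRange n).Pairwise (· < ·) := List.pairwise_lt_finRange n
  have hl : (List.finRange n).length = I.blocks.sum := by simp [I.blocks_sum]
  rw [blockProd_splits, ← List.sum_toFinset _ (nodup_arrangements _ _ hs hl)]
  refine Finset.sum_bij (fun σ _ => List.ofFn σ) ?_ ?_ ?_ ?_
  · intro σ hσ
    rw [List.mem_toFinset, mem_arrangements _ _ hs hl, ← descentSet_subset_iff]
    exact ⟨by rw [List.ofFn_eq_map]; exact Equiv.Perm.map_finRange_perm σ,
      (Finset.mem_filter.1 hσ).2⟩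
  · intro σ _ τ _ h
    exact Equiv.coe_fn_injective (List.ofFn_injective h)
  · intro v hv
    rw [List.mem_toFinset, mem_arrangements _ _ hs hl] at hv
    obtain ⟨σ, rfl⟩ := exists_perm_of_perm_finRange hv.1
    exact ⟨σ, Finset.mem_filter.2 ⟨Finset.mem_univ _, (descentSet_subset_iff σ I).2 hv.2⟩, rfl⟩
  · intro σ _
    exact toWords_of K σ

theorem toWords_nsymOf (φ : List ℕ → ℤ) (n : ℕ) :
    toWords K n (toGroupAlgebra K n (nsymOf K φ n)) =
      blockSum splits List.length (wordProd (FreeAlgebra.ι K)) wordUnit φ n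
        (List.finRange n) := by
  simp only [nsymOf, map_sum, toGroupAlgebra, Finsupp.linearCombination_single, map_zsmul,
    Int.cast_smul_eq_zsmul, sum_descentSet_subset, blockSum]

theorem toWords_psiBar (n : ℕ) :
    toWords K n (toGroupAlgebra K n (nsymOf K psiBarCoeff n)) = rightDynkin K n := by
  have := blockSum_psiBar_splits (FreeAlgebra.ι K) (List.finRange n)
  rw [List.length_finRange] at this
  rw [toWords_nsymOf, this, rightDynkin, List.ofFn_eq_map]

theorem toWords_psi (n : ℕ) :
    toWords K n (toGroupAlgebra K n (nsymOf K psiCoeff n)) = leftDynkin K n := by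
  have := blockSum_psi_splits (FreeAlgebra.ι K) (List.finRange n)
  rw [List.length_finRange] at this
  rw [toWords_nsymOf, this, leftDynkin, List.ofFn_eq_map]

end Descents

/-! ### Uniqueness: injectivity of the two identifications -/

section Injectivity
variable (K : Type*) [CommRing K]

/-- Distinct permutations give distinct words, hence distinct members of the monomial basis of the
free algebra. -/
theorem toWords_injective (n : ℕ) : Function.Injective (toWords K n) := by
  have hb := (FreeAlgebra.basisFreeMonoid K (Fin n)).linearIndependent
  have hi : Function.Injective fun σ : Equiv.Perm (Fin n) => FreeMonoid.ofList (List.ofFn σ) :=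
    fun σ τ h => Equiv.coe_fn_injective (List.ofFn_injective (FreeMonoid.ofList.injective h))
  have h := hb.comp _ hi
  have he : (⇑(FreeAlgebra.basisFreeMonoid K (Fin n)) ∘
      fun σ : Equiv.Perm (Fin n) => FreeMonoid.ofList (List.ofFn σ)) =
      fun σ : Equiv.Perm (Fin n) => (List.ofFn fun i => FreeAlgebra.ι K (σ i)).prod := by
    funext σ
    rw [Function.comp_apply, FreeAlgebra.basisFreeMonoid, Module.Basis.map_apply,
      Finsupp.coe_basisSingleOne]
    change MonoidAlgebra.lift K (FreeAlgebra K (Fin n)) (FreeMonoid (Fin n))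
      (FreeMonoid.lift (FreeAlgebra.ι K)) (MonoidAlgebra.single _ 1) = _
    rw [MonoidAlgebra.lift_single, one_smul, FreeMonoid.lift_apply, FreeMonoid.toList_ofList,
      List.map_ofFn]
    rfl
  rw [he] at h
  unfold toWords
  rw [LinearMap.coe_comp]
  exact Function.Injective.comp h (MonoidAlgebra.coeffLinearEquiv K).injective

/-- Every set of places is the descent set of a permutation. -/
theorem exists_perm_descentSet {n : ℕ} (D : Finset (Fin (n + 1))) :
    ∃ σ : Equiv.Perm (Fin n), ∀ d, d ∈ descentSet σ ↔ d ∈ D ∧ d ≠ 0 ∧ d ≠ Fin.last n := by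
  let c : ℕ → ℕ := fun i => (D.filter fun d : Fin (n + 1) => (d : ℕ) ≤ i).card
  -- The value drops by `n` at each place of `D` and otherwise increases by `1`, so the descents of
  -- `g` are as wanted. Values are distinct modulo `n`, and the inverse of the sorting permutation
  -- has the same relative order as `g`.
  let g : Fin n → ℤ := fun i => (i : ℤ) - n * c i
  let τ := Tuple.sort g
  have hg : Function.Injective g := by
    intro i j h
    have h1 : (i : ℤ) % n = (j : ℤ) % n := by
      have hi : (i : ℤ) = g i + n * c i := by simp [g]
      have hj : (j : ℤ) = g j + n * c j := by simp [g]
      rw [hi, hj, h]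
      simp
    rw [Int.emod_eq_of_lt (by omega) (by omega), Int.emod_eq_of_lt (by omega) (by omega)] at h1
    exact Fin.ext (by omega)
  have hmono : StrictMono (g ∘ τ) :=
    (Tuple.monotone_sort g).strictMono_of_injective (hg.comp τ.injective)
  have hlt : ∀ i j, τ⁻¹ i < τ⁻¹ j ↔ g i < g j := by
    intro i j
    rw [← hmono.lt_iff_lt]
    simp
  refine ⟨τ⁻¹, fun d => ?_⟩
  have hstep : ∀ i j : Fin n, (i : ℕ) + 1 = d → (j : ℕ) = d → (g j < g i ↔ d ∈ D) := by
    intro i j hi hj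
    have hcard : c j = c i + if d ∈ D then 1 else 0 := by
      have : (D.filter fun x : Fin (n + 1) => (x : ℕ) ≤ j) =
          (D.filter fun x : Fin (n + 1) => (x : ℕ) ≤ i) ∪ D.filter fun x : Fin (n + 1) => x = d := by
        ext x
        simp only [Finset.mem_filter, Finset.mem_union, ← and_or_left, Fin.ext_iff]
        refine and_congr_right fun _ => ?_
        omega
      simp only [c]
      rw [this, Finset.card_union_of_disjoint, Finset.filter_eq']
      · split_ifs <;> simp
      · rw [Finset.disjoint_left]
        intro x hx hx'
        have h1 := (Finset.mem_filter.1 hx).2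
        have h2 := congrArg Fin.val (Finset.mem_filter.1 hx').2
        omega
    simp only [g, hcard]
    have := j.2
    split_ifs with h
    · simp only [h, iff_true]
      push_cast
      rw [mul_add, mul_one]
      omega
    · simp only [h, iff_false]
      push_cast
      rw [add_zero]
      omega
  simp only [descentSet, Finset.mem_filter, Finset.mem_univ, true_and]
  constructor
  · rintro ⟨i, j, hi, hj, h⟩
    refine ⟨(hstep i j hi hj).1 ((hlt _ _).1 h), ?_, ?_⟩
    · rintro rfl
      simp at hi
    · rintro rfl
      simp at hj
      omega
  · rintro ⟨hd, h0, hl⟩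
    have h0 : (d : ℕ) ≠ 0 := fun h => h0 (Fin.ext h)
    have hl : (d : ℕ) ≠ n := fun h => hl (Fin.ext h)
    have := d.2
    refine ⟨⟨d - 1, by omega⟩, ⟨d, by omega⟩, by simp; omega, rfl, ?_⟩
    rw [hlt, hstep _ _ (by simp; omega) rfl]
    exact hd

theorem boundaries_injective (n : ℕ) :
    Function.Injective (Composition.boundaries : Composition n → Finset (Fin (n + 1))) :=
  fun _ _ h => (compositionEquiv n).injective (CompositionAsSet.ext h)

/-- Triangularity for inclusion of boundaries: if `I` in the support has the most boundaries and `σ`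
has exactly its interior boundaries as descents, then only `S^I` contributes to the coefficient of
`σ`. -/
theorem toGroupAlgebra_injective (n : ℕ) : Function.Injective (toGroupAlgebra K n) := by
  rw [injective_iff_map_eq_zero]
  intro P hP
  by_contra hne
  obtain ⟨I, hI, hmax⟩ := Finset.exists_max_image P.support (fun I => I.boundaries.card)
    (Finsupp.support_nonempty_iff.2 hne)
  obtain ⟨σ, hσ⟩ := exists_perm_descentSet I.boundaries
  have hsub : ∀ J : Composition n, descentSet σ ⊆ J.boundaries ↔ I.boundaries ⊆ J.boundaries := by
    intro J
    refine ⟨fun h d hd => ?_, fun h d hd => h ((hσ d).1 hd).1⟩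
    by_cases h0 : d = 0
    · exact h0 ▸ J.toCompositionAsSet.zero_mem
    · by_cases hl : d = Fin.last n
      · exact hl ▸ J.toCompositionAsSet.getLast_mem
      · exact h ((hσ d).2 ⟨hd, h0, hl⟩)
  have h : (toGroupAlgebra K n P).coeff σ = P I := by
    rw [toGroupAlgebra, Finsupp.linearCombination_apply, Finsupp.sum]
    simp only [MonoidAlgebra.of_apply, MonoidAlgebra.coeff_sum, MonoidAlgebra.coeff_smul,
      MonoidAlgebra.coeff_single, Finsupp.finsetSum_apply, Finsupp.smul_apply,
      Finsupp.single_apply, Finset.sum_ite_eq', Finset.mem_filter, Finset.mem_univ, true_and, hsub]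
    rw [Finset.sum_eq_single_of_mem I hI]
    · simp
    · intro J hJ hJI
      rw [if_neg, smul_zero]
      intro h
      exact hJI (boundaries_injective n (Finset.eq_of_subset_of_card_le h (hmax J hJ))).symm
  rw [hP] at h
  exact Finsupp.mem_support_iff.1 hI h.symm

end Injectivity
end NCK

theorem mainTheorem7 {K : Type*} [CommRing K] (n : ℕ) (hn : 1 ≤ n) :
    ∃ PsiBar Psi : NCK.NSym K n,
      -- `PsiBar` and `Psi` are the right and left Dynkin elements, regarded in `Sym`
      (∀ P : NCK.NSym K n,
        NCK.toWords K n (NCK.toGroupAlgebra K n P) = NCK.rightDynkin K n ↔ P = PsiBar) ∧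
      (∀ P : NCK.NSym K n,
        NCK.toWords K n (NCK.toGroupAlgebra K n P) = NCK.leftDynkin K n ↔ P = Psi) ∧
      -- their expansions on the `X`-basis
      NCK.toHDual K n PsiBar = ∑ T ∈ NCK.PlaneTree.ofSize n, NCK.X K T.toForest ∧
      NCK.toHDual K n Psi = NCK.X K (NCK.PlaneForest.linear n) ∧
      NCK.toHDual K n Psi =
        NCK.treeIncl K
          ((fun x => NCK.preLie x (Finsupp.single NCK.PlaneTree.single 1))^[n - 1]
            (Finsupp.single NCK.PlaneTree.single 1)) := by
  have hinj : Function.Injective fun P : NCK.NSym K n =>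
      NCK.toWords K n (NCK.toGroupAlgebra K n P) :=
    (NCK.toWords_injective K n).comp (NCK.toGroupAlgebra_injective K n)
  refine ⟨NCK.nsymOf K NCK.psiBarCoeff n, NCK.nsymOf K NCK.psiCoeff n, fun P => ?_, fun P => ?_,
    NCK.toHDual_psiBar K n, NCK.toHDual_psi K n hn, ?_⟩
  · rw [← NCK.toWords_psiBar]
    exact hinj.eq_iff
  · rw [← NCK.toWords_psi]
    exact hinj.eq_iff
  · rw [NCK.toHDual_psi K n hn, NCK.treeIncl_preLie_iterate K n hn]
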